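/- Write $2^{[0,1]}$ for the collection of nonempty compact subsets of $[0,1]$, and let $f:[0,1]\to 2^{[0,1]}$ with graph $G(f)=\{(x,y)\in[0,1]^2: y\in f(x)\}$. Assume that 1. $f$ is upper semicontinuous: for every $x$ and every open $U\supseteq f(x)$ there is an open $V\ni x$ with $f(z)\subseteq U$ for all $z\in V$; 2. $f$ is surjective: every $y\in[0,1]$ lies in $f(x)$ for some $x$; 3. $f$ is almost nonfissile: the set of points $(x,y)\in G(f)$ for which $f(x)$ is a singleton is a dense $G_\delta$ subset of $G(f)$; 4. $f$ is light: for every $y\in[0,1]$ the set $\{x\in[0,1]: y\in f(x)\}$ has empty interior; 5. $f$ has the intermediate value property: whenever $x_1\ne x_2$, $y_1\in f(x_1)$, $y_2\in f(x_2)$, $y_1\neq y_2$, and $y$ is strictly between $y_1$ and $y_2$, there is $x$ strictly between $x_1$ and $x_2$ with $y\in f(x)$; 6. $G(f)$ has empty interior in $[0,1]^2$. Suppose that $f$ has a periodic orbit whose period is not a power of $2$ (where $1=2^0$ counts as a power of $2$), that is, a sequence $(x_i)_{i\ge 0}$ with $x_{i+1}\in f(x_i)$ for all $i$, such that the least integer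 $n\ge 1$ with $x_{n+i}=x_i$ for all $i\geq 0$ exists and is not a power of $2$. Then the inverse limit $$\varprojlim\{[0,1],f\}=\Big\{(x_0,x_1,\dots)\in[0,1]^{\mathbb N}: x_{i}\in f(x_{i+1})\text{ for all } i\ge 0\Big\},$$ with the subspace topology of the product, contains an indecomposable subcontinuum, i.e. a nonempty compact connected subset with more than one point that is not the union of two proper subsets each of which is nonempty, compact and connected. -/

import Mathlib

open TopologicalSpace

/-- The set `2^X` of nonempty compact subsets of `X` is `NonemptyCompacts X`; the definitions
below concern set-valued functions `f : X → 2^Y`. Upper semicontinuity is Mathlib's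
`UpperHemicontinuous`; `IsUSC` only inserts the coercion to sets. -/
def SetValued.IsUSC {X Y : Type*} [TopologicalSpace X] [TopologicalSpace Y]
    (f : X → NonemptyCompacts Y) : Prop :=
  UpperHemicontinuous (fun x => (f x : Set Y))

namespace SetValued

/-- Upper semicontinuity in terms of open sets. -/
theorem isUSC_iff {X Y : Type*} [TopologicalSpace X] [TopologicalSpace Y]
    (f : X → NonemptyCompacts Y) :
    IsUSC f ↔ ∀ x, ∀ U : Set Y, IsOpen U → (f x : Set Y) ⊆ U →
      ∃ V : Set X, IsOpen V ∧ x ∈ V ∧ ∀ z ∈ V, (f z : Set Y) ⊆ U := by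
  constructor
  · intro h x U hU hxU
    obtain ⟨V, hV, hVo, hxV⟩ := eventually_nhds_iff.1 (h x U (hU.mem_nhdsSet.2 hxU))
    exact ⟨V, hVo, hxV, fun z hz => hU.mem_nhdsSet.1 (hV z hz)⟩
  · intro h x t ht
    obtain ⟨U, hU, hxU, hUt⟩ := mem_nhdsSet_iff_exists.1 ht
    obtain ⟨V, hV, hxV, hVU⟩ := h x U hU hxU
    exact eventually_nhds_iff.2
      ⟨V, fun z hz => mem_nhdsSet_iff_exists.2 ⟨U, hU, hVU z hz, hUt⟩, hV, hxV⟩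

/-- The graph `G(f) = {(x, y) : y ∈ f x}`. -/
def graph {X Y : Type*} [TopologicalSpace Y] (f : X → NonemptyCompacts Y) : Set (X × Y) :=
  {p | p.2 ∈ f p.1}

/-- `f` is surjective: every point of `Y` lies in some value of `f`. -/
def IsSurjective {X Y : Type*} [TopologicalSpace Y] (f : X → NonemptyCompacts Y) : Prop :=
  ∀ y, ∃ x, y ∈ f x

/-- `x` is a nonfissile point of `f`: the value `f x` is a singleton. -/
def IsNonfissile {X Y : Type*} [TopologicalSpace Y] (f : X → NonemptyCompacts Y) (x : X) : Prop :=
  ∃ y, (f x : Set Y) = {y}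

/-- The points of `G(f)` lying over nonfissile points of `f` form a dense `G_δ` subset of the
space `G(f)`. -/
def IsAlmostNonfissile {X Y : Type*} [TopologicalSpace X] [TopologicalSpace Y]
    (f : X → NonemptyCompacts Y) : Prop :=
  Dense {p : graph f | IsNonfissile f p.1.1} ∧ IsGδ {p : graph f | IsNonfissile f p.1.1}

/-- `f` is light: each set `{x : y ∈ f x}` has empty interior. -/
def IsLight {X Y : Type*} [TopologicalSpace X] [TopologicalSpace Y]
    (f : X → NonemptyCompacts Y) : Prop :=
  ∀ y, interior {x | y ∈ f x} = ∅

/-- The intermediate value property. Here `Set.uIoo a b` is the set of points strictly between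
`a` and `b`, in whichever order these come. -/
def HasIVP {X Y : Type*} [LinearOrder X] [LinearOrder Y] [TopologicalSpace Y]
    (f : X → NonemptyCompacts Y) : Prop :=
  ∀ x₁ x₂, x₁ ≠ x₂ → ∀ y₁ ∈ f x₁, ∀ y₂ ∈ f x₂, y₁ ≠ y₂ →
    ∀ y ∈ Set.uIoo y₁ y₂, ∃ x ∈ Set.uIoo x₁ x₂, y ∈ f x

/-- An orbit of `f`. -/
def IsOrbit {X : Type*} [TopologicalSpace X] (f : X → NonemptyCompacts X) (x : ℕ → X) : Prop :=
  ∀ i, x (i + 1) ∈ f (x i)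

/-- The sequence `x` is a periodic orbit of `f` of period `n`, the period being the least positive
integer `n` with `x (n + i) = x i` for all `i`. -/
def IsPeriodicOrbit {X : Type*} [TopologicalSpace X] (f : X → NonemptyCompacts X)
    (x : ℕ → X) (n : ℕ) : Prop :=
  IsOrbit f x ∧ IsLeast {m : ℕ | 0 < m ∧ ∀ i, x (m + i) = x i} n

/-- The inverse limit of the inverse sequence with all factor spaces `X` and all bonding functions
`f`, as a subset of the product `X^ℕ`. -/
def inverseLimit {X : Type*} [TopologicalSpace X] (f : X → NonemptyCompacts X) : Set (ℕ → X) :=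
  {x | ∀ i, x i ∈ f (x (i + 1))}

end SetValued

/-- A subset of a (metrizable) space is a continuum if it is nonempty, compact and connected;
nonemptiness is part of `IsConnected`. -/
def IsContinuum {Z : Type*} [TopologicalSpace Z] (K : Set Z) : Prop :=
  IsCompact K ∧ IsConnected K

/-- An indecomposable continuum: a continuum with more than one point that is not the union of two
proper subcontinua. -/
def IsIndecomposableContinuum {Z : Type*} [TopologicalSpace Z] (K : Set Z) : Prop :=
  IsContinuum K ∧ K.Nontrivial ∧
    ¬ ∃ A B : Set Z, IsContinuum A ∧ IsContinuum B ∧ A ⊂ K ∧ B ⊂ K ∧ A ∪ B = K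

namespace SetValued

open Set

/-! The proof passes through a horseshoe: two nonoverlapping intervals, each of which an iterate of
`img f` stretches over the hull `J` of both.

If a point of the periodic orbit has two different successors, the image of any interval through it
covers the gap between them; each half of that gap returns to the branch point, which gives a
horseshoe. Otherwise write the period as `2 ^ k * q` with `q` odd, `q > 1`. The `2 ^ k`-th iterate
has an orbit of odd period that never stays put, and the classical interval argument applies
(`hasHorseshoe_of_odd`).

Given a horseshoe for the `m`-th iterate, let the factors `L i` be closures of unions of iterates of
`J`, chosen so that `f` maps each onto the preceding one; let `K` be their inverse limit. If `K = A
∪ B`, the projections of `A` and `B` are intervals, so far out one of them contains a leg of the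
horseshoe, and `m` levels nearer it contains `J`. One of `A`, `B` does so at infinitely many levels.
Hence all its projections are full, and being closed it is all of `K`.

The difficulty is that a point of `A` selects only one value of `f`, so a projection need not
contain the image of the next one. `IsTame.exists_open_subset` repairs this: arbitrarily near any
graph point there are arguments all of whose values are near the given one. -/

/-- The conditions on a set-valued function of the interval used throughout: upper semicontinuity,
density of the nonfissile points of the graph, lightness, the intermediate value property. -/
structure IsTame (f : unitInterval → NonemptyCompacts unitInterval) : Prop where
  usc : IsUSC f
  dense_nonfissile : Dense {p : graph f | IsNonfissile f p.1.1}
  light : IsLight f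
  ivp : HasIVP f

/-! ### Images of intervals -/

/-- The image of a set under a set-valued function. -/
def img {X Y : Type*} [TopologicalSpace Y] (f : X → NonemptyCompacts Y) (S : Set X) : Set Y :=
  {y | ∃ x ∈ S, y ∈ f x}

theorem img_mono {X Y : Type*} [TopologicalSpace Y] (f : X → NonemptyCompacts Y) :
    Monotone (img f) :=
  fun _ _ h _ ⟨x, hx, hy⟩ => ⟨x, h hx, hy⟩

/-- Nondegenerate intervals of a linear order. -/
structure IsNondegInterval {X : Type*} [Preorder X] (S : Set X) : Prop where
  ord : S.OrdConnected
  nontrivial : S.Nontrivial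

theorem isNondegInterval_Icc {X : Type*} [PartialOrder X] {a b : X} (h : a < b) :
    IsNondegInterval (Icc a b) :=
  ⟨ordConnected_Icc, a, left_mem_Icc.2 h.le, b, right_mem_Icc.2 h.le, h.ne⟩

theorem uIoo_subset_of_ordConnected {X : Type*} [LinearOrder X] {S : Set X} (hS : S.OrdConnected)
    {a b : X} (ha : a ∈ S) (hb : b ∈ S) : uIoo a b ⊆ S :=
  uIoo_subset_uIcc_self.trans (hS.uIcc_subset ha hb)

theorem isOpen_uIoo {a b : unitInterval} : IsOpen (uIoo a b) := isOpen_Ioo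

/-- A point of a nondegenerate interval has arbitrarily small neighbourhoods in that interval that
are nondegenerate intervals. -/
theorem IsNondegInterval.exists_subset {S U : Set unitInterval} (hS : IsNondegInterval S)
    {x : unitInterval} (hx : x ∈ S) (hU : IsOpen U) (hxU : x ∈ U) :
    ∃ T ⊆ S ∩ U, IsNondegInterval T ∧ x ∈ T := by
  obtain ⟨y, hy, hyx⟩ := hS.nontrivial.exists_ne x
  rcases lt_or_gt_of_ne hyx with h | h
  · obtain ⟨l, hl, hlU⟩ := exists_Ioc_subset_of_mem_nhds (hU.mem_nhds hxU) ⟨y, h⟩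
    obtain ⟨z, hz, hzx⟩ := exists_between (max_lt h hl)
    refine ⟨Icc z x, fun t ht => ⟨hS.ord.out hy hx ⟨?_, ht.2⟩, hlU ⟨?_, ht.2⟩⟩,
      isNondegInterval_Icc hzx, right_mem_Icc.2 hzx.le⟩
    · exact ((le_max_left _ _).trans hz.le).trans ht.1
    · exact ((le_max_right _ _).trans_lt hz).trans_le ht.1
  · obtain ⟨u, hu, huU⟩ := exists_Ico_subset_of_mem_nhds (hU.mem_nhds hxU) ⟨y, h⟩
    obtain ⟨z, hzx, hz⟩ := exists_between (lt_min h hu)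
    refine ⟨Icc x z, fun t ht => ⟨hS.ord.out hx hy ⟨ht.1, ?_⟩, huU ⟨ht.1, ?_⟩⟩,
      isNondegInterval_Icc hzx, left_mem_Icc.2 hzx.le⟩
    · exact ht.2.trans (hz.le.trans (min_le_left _ _))
    · exact ht.2.trans_lt (hz.trans_le (min_le_right _ _))

theorem IsNondegInterval.interior_nonempty {S : Set unitInterval} (hS : IsNondegInterval S) :
    (interior S).Nonempty := by
  obtain ⟨a, ha, b, hb, hab⟩ := hS.nontrivial
  exact (nonempty_uIoo.2 hab).mono
    (interior_maximal (uIoo_subset_of_ordConnected hS.ord ha hb) isOpen_uIoo)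

theorem IsNondegInterval.closure {S : Set unitInterval} (hS : IsNondegInterval S) :
    IsNondegInterval (closure S) :=
  ⟨isPreconnected_iff_ordConnected.1 (isPreconnected_iff_ordConnected.2 hS.ord).closure,
    hS.nontrivial.mono subset_closure⟩

variable {f : unitInterval → NonemptyCompacts unitInterval}

/-- The graph of an upper semicontinuous function is closed. -/
theorem IsUSC.isClosed_graph (hf : IsUSC f) : IsClosed (graph f) := by
  rw [← isOpen_compl_iff, isOpen_iff_mem_nhds]
  rintro ⟨x, y⟩ hxy
  obtain ⟨U, V, hU, hV, hfU, hyV, hUV⟩ := SeparatedNhds.of_isCompact_isCompact (f x).isCompact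
    (isCompact_singleton (x := y)) (disjoint_singleton_right.2 hxy)
  obtain ⟨O, hO, hxO, hOU⟩ := (isUSC_iff f).1 hf x U hU hfU
  filter_upwards [(hO.prod hV).mem_nhds ⟨hxO, hyV rfl⟩] with p hp hpf
  exact hUV.le_bot ⟨hOU _ hp.1 hpf, hp.2⟩

theorem IsUSC.isOpen_setOf_subset (hf : IsUSC f) {U : Set unitInterval} (hU : IsOpen U) :
    IsOpen {x | (f x : Set unitInterval) ⊆ U} := by
  rw [isOpen_iff_mem_nhds]
  intro x hx
  obtain ⟨V, hV, hxV, hVU⟩ := (isUSC_iff f).1 hf x U hU hx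
  exact Filter.mem_of_superset (hV.mem_nhds hxV) hVU

theorem IsUSC.isClosed_img (hf : IsUSC f) {S : Set unitInterval} (hS : IsClosed S) :
    IsClosed (img f S) := by
  have : img f S = Prod.snd '' (graph f ∩ Prod.fst ⁻¹' S) := by
    ext y
    constructor
    · rintro ⟨x, hx, hy⟩
      exact ⟨(x, y), ⟨hy, hx⟩, rfl⟩
    · rintro ⟨p, ⟨hp, hx⟩, rfl⟩
      exact ⟨p.1, hx, hp⟩
  rw [this]
  exact ((hf.isClosed_graph.inter (hS.preimage continuous_fst)).isCompact.image
    continuous_snd).isClosed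

/-- By lightness, no value is taken at all points of a nondegenerate interval. -/
theorem IsLight.exists_notMem (hf : IsLight f) {S : Set unitInterval} (hS : IsNondegInterval S)
    (y : unitInterval) : ∃ u ∈ S, y ∉ f u := by
  by_contra! h
  obtain ⟨x, hx⟩ := hS.interior_nonempty
  have : x ∈ interior {x | y ∈ f x} := interior_mono (fun u hu => h u hu) hx
  simp [hf y] at this

theorem IsTame.img_interval (hf : IsTame f) {S : Set unitInterval} (hS : IsNondegInterval S) :
    IsNondegInterval (img f S) := by
  refine ⟨⟨?_⟩, ?_⟩
  · rintro y₁ ⟨x₁, hx₁, hy₁⟩ y₂ ⟨x₂, hx₂, hy₂⟩ y ⟨h₁, h₂⟩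
    rcases h₁.eq_or_lt with rfl | h₁
    · exact ⟨x₁, hx₁, hy₁⟩
    rcases h₂.eq_or_lt with rfl | h₂
    · exact ⟨x₂, hx₂, hy₂⟩
    have key : ∀ a ∈ S, ∀ b ∈ S, a ≠ b → ∀ c ∈ f a, ∀ d ∈ f b, c < y → y < d → y ∈ img f S := by
      intro a ha b hb hab c hc d hd hcy hyd
      obtain ⟨x, hx, hxy⟩ :=
        hf.ivp a b hab c hc d hd (hcy.trans hyd).ne y (mem_uIoo_of_lt hcy hyd)
      exact ⟨x, uIoo_subset_of_ordConnected hS.ord ha hb hx, hxy⟩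
    -- The intermediate value property compares distinct arguments only; over a single argument, a
    -- value at a third point lies on one side of `y` and can replace one of the two.
    by_cases h : x₁ = x₂
    · subst h
      obtain ⟨x₃, hx₃, hne⟩ := hS.nontrivial.exists_ne x₁
      obtain ⟨y₃, hy₃⟩ := (f x₃).nonempty
      rcases lt_trichotomy y₃ y with h | rfl | h
      · exact key x₃ hx₃ x₁ hx₁ hne y₃ hy₃ y₂ hy₂ h h₂
      · exact ⟨x₃, hx₃, hy₃⟩
      · exact key x₁ hx₁ x₃ hx₃ hne.symm y₁ hy₁ y₃ hy₃ h₁ h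
    · exact key x₁ hx₁ x₂ hx₂ h y₁ hy₁ y₂ hy₂ h₁ h₂
  · obtain ⟨x, hx⟩ := hS.nontrivial.nonempty
    obtain ⟨y, hy⟩ := (f x).nonempty
    obtain ⟨u, hu, hyu⟩ := hf.light.exists_notMem hS y
    obtain ⟨v, hv⟩ := (f u).nonempty
    exact ⟨y, ⟨x, hx, hy⟩, v, ⟨u, hu, hv⟩, fun h => hyu (h ▸ hv)⟩

theorem IsTame.iterate_img_interval (hf : IsTame f) {S : Set unitInterval}
    (hS : IsNondegInterval S) (k : ℕ) : IsNondegInterval ((img f)^[k] S) := by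
  induction k with
  | zero => exact hS
  | succ k ih => rw [Function.iterate_succ_apply']; exact hf.img_interval ih

/-- The values of a tame function are intervals. -/
theorem IsTame.ordConnected_value (hf : IsTame f) (x : unitInterval) :
    (f x : Set unitInterval).OrdConnected := by
  refine ⟨fun y₁ hy₁ y₂ hy₂ y hy => ?_⟩
  have huniv : IsNondegInterval (univ : Set unitInterval) := ⟨ordConnected_univ, nontrivial_univ⟩
  -- Images of small intervals around `x` are intervals containing `y₁` and `y₂`, so `y` is taken
  -- arbitrarily near `x`; the closed graph does the rest.
  have : x ∈ closure {s | y ∈ f s} := by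
    refine mem_closure_iff.2 fun U hU hxU => ?_
    obtain ⟨T, hTU, hT, hxT⟩ := huniv.exists_subset (mem_univ x) hU hxU
    obtain ⟨s, hs, hys⟩ := (hf.img_interval hT).ord.out ⟨x, hxT, hy₁⟩ ⟨x, hxT, hy₂⟩ hy
    exact ⟨s, (hTU hs).2, hys⟩
  have hcl : IsClosed {s | y ∈ f s} :=
    hf.usc.isClosed_graph.preimage (continuous_id.prodMk continuous_const)
  rwa [hcl.closure_eq] at this

/-! ### Approximation through nonfissile points -/

/-- Every point of the graph over a nondegenerate interval `S` can be approximated by open sets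
of arguments in `S` with small values. -/
theorem IsTame.exists_open_subset (hf : IsTame f) {S U : Set unitInterval}
    (hS : IsNondegInterval S) {s w : unitInterval} (hs : s ∈ S) (hw : w ∈ f s) (hU : IsOpen U)
    (hwU : w ∈ U) :
    ∃ W ⊆ S, IsOpen W ∧ W.Nonempty ∧ ∀ u ∈ W, (f u : Set unitInterval) ⊆ U := by
  -- Moving from `u`, where `w` is not a value, to `s` forces values near `w` strictly between `u`
  -- and `s`. This makes the graph meet an open box over the interior of `S`, where a nonfissile
  -- point can be found.
  obtain ⟨u, hu, hwu⟩ := hf.light.exists_notMem hS w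
  obtain ⟨v, hv⟩ := (f u).nonempty
  have hwv : v ≠ w := fun h => hwu (h ▸ hv)
  have hus : u ≠ s := by rintro rfl; exact hwu hw
  obtain ⟨y, hyU, hy⟩ : ∃ y ∈ U, y ∈ uIoo v w := by
    have hI : IsNondegInterval (uIcc v w) := isNondegInterval_Icc (by simpa using hwv.symm)
    obtain ⟨T, hTU, hT, -⟩ := hI.exists_subset right_mem_uIcc hU hwU
    obtain ⟨a, ha, b, hb, hab⟩ := hT.nontrivial
    obtain ⟨t, ht⟩ := nonempty_uIoo.2 hab
    refine ⟨t, (hTU (uIoo_subset_of_ordConnected hT.ord ha hb ht)).2, ?_⟩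
    exact uIoo_subset_Ioo (hTU ha).1 (hTU hb).1 ht
  obtain ⟨x, hx, hxy⟩ := hf.ivp u s hus v hv w hw hwv y hy
  have hopen : IsOpen {p : graph f | p.1 ∈ uIoo u s ×ˢ U} :=
    (isOpen_uIoo.prod hU).preimage continuous_subtype_val
  obtain ⟨⟨⟨x', y'⟩, hp⟩, ⟨hx', hy'⟩, z, hz⟩ :=
    hf.dense_nonfissile.inter_open_nonempty _ hopen ⟨⟨(x, y), hxy⟩, hx, hyU⟩
  refine ⟨uIoo u s ∩ {x | (f x : Set unitInterval) ⊆ U},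
    inter_subset_left.trans (uIoo_subset_of_ordConnected hS.ord hu hs),
    isOpen_uIoo.inter (hf.usc.isOpen_setOf_subset hU), ⟨x', hx', ?_⟩, fun u hu => hu.2⟩
  have hyz : y' ∈ (f x' : Set unitInterval) := hp
  change (f x' : Set unitInterval) = {z} at hz
  rw [hz, mem_singleton_iff] at hyz
  change (f x' : Set unitInterval) ⊆ U
  rw [hz, ← hyz]
  exact singleton_subset_iff.2 hy'

/-- A value at an endpoint of `S` is a limit of values inside `S`, by `IsTame.exists_open_subset`;
upper semicontinuity alone gives only the other inclusion. -/
theorem IsTame.img_closure (hf : IsTame f) {S : Set unitInterval} (hS : IsNondegInterval S) :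
    img f (closure S) = closure (img f S) := by
  apply Subset.antisymm
  · rintro w ⟨s, hs, hw⟩
    refine mem_closure_iff.2 fun U hU hwU => ?_
    obtain ⟨W, hWS, hW, ⟨u, hu⟩, hWU⟩ := hf.exists_open_subset hS.closure hs hw hU hwU
    obtain ⟨t, ht, htS⟩ := mem_closure_iff.1 (hWS hu) W hW hu
    obtain ⟨v, hv⟩ := (f t).nonempty
    exact ⟨v, hWU t ht hv, t, htS, hv⟩
  · exact closure_minimal (img_mono f subset_closure) (hf.usc.isClosed_img isClosed_closure)

/-- Thin tubes: near a finite backward orbit `x 0, …, x N` there is an open set of points all of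
whose forward orbits follow it. -/
theorem IsTame.exists_tube (hf : IsTame f) {U : ℕ → Set unitInterval} (hU : ∀ i, IsOpen (U i))
    {x : ℕ → unitInterval} (hxU : ∀ i, x i ∈ U i) (hx : ∀ i, x i ∈ f (x (i + 1))) (N : ℕ)
    {S : Set unitInterval} (hS : IsNondegInterval S) (hxS : x N ∈ S) :
    ∃ W ⊆ S, IsOpen W ∧ W.Nonempty ∧ ∀ z : ℕ → unitInterval,
      (∀ i < N, z i ∈ f (z (i + 1))) → z N ∈ W → ∀ i ≤ N, z i ∈ U i := by
  induction N generalizing S with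
  | zero =>
    obtain ⟨T, hTU, hT, -⟩ := hS.exists_subset hxS (hU 0) (hxU 0)
    refine ⟨interior T, interior_subset.trans (hTU.trans inter_subset_left), isOpen_interior,
      hT.interior_nonempty, fun z _ hz i hi => ?_⟩
    obtain rfl : i = 0 := by omega
    exact (hTU (interior_subset hz)).2
  | succ N ih =>
    obtain ⟨T, hTU, hT, hxT⟩ := hS.exists_subset hxS (hU _) (hxU _)
    -- The shorter tube is built inside the image of `T`, so that its points have preimages in `T`.
    obtain ⟨W', hW'T, hW', ⟨w, hw⟩, htube⟩ := ih (hf.img_interval hT) ⟨_, hxT, hx N⟩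
    obtain ⟨s, hs, hws⟩ := hW'T hw
    obtain ⟨W, hWT, hW, hWne, hWW'⟩ := hf.exists_open_subset hT hs hws hW' hw
    refine ⟨W, hWT.trans (hTU.trans inter_subset_left), hW, hWne, fun z hz hzN i hi => ?_⟩
    rcases hi.eq_or_lt with rfl | hi
    · exact (hTU (hWT hzN)).2
    · exact htube z (fun i hi => hz i (by omega)) (hWW' _ hzN (hz N (by omega))) i (by omega)

/-! ### Horseshoes from periodic orbits -/

/-- An operator on sets has a horseshoe if it stretches each of two nonoverlapping nondegenerate
closed intervals over both. -/
def HasHorseshoe {X : Type*} [LinearOrder X] (Φ : Set X → Set X) : Prop :=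
  ∃ p₁ p₂ q₁ q₂ : X, p₁ < p₂ ∧ p₂ ≤ q₁ ∧ q₁ < q₂ ∧
    Icc p₁ q₂ ⊆ Φ (Icc p₁ p₂) ∧ Icc p₁ q₂ ⊆ Φ (Icc q₁ q₂)

theorem monotone_iterate_of_subset {X : Type*} {Φ : Set X → Set X} (hΦ : Monotone Φ) {S : Set X}
    (hS : S ⊆ Φ S) : Monotone fun k => Φ^[k] S :=
  monotone_nat_of_le_succ fun k => by
    simpa only [Function.iterate_succ_apply] using hΦ.iterate k hS

theorem mem_iterate_of_orbit {X : Type*} {Φ : Set X → Set X} (P : Set X → Prop)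
    (hP : ∀ S, P S → P (Φ S)) {y : ℕ → X} (hy : ∀ S, P S → ∀ i, y i ∈ S → y (i + 1) ∈ Φ S)
    {S : Set X} (hS : P S) {i : ℕ} (hi : y i ∈ S) (k : ℕ) : y (i + k) ∈ Φ^[k] S := by
  induction k generalizing S i with
  | zero => exact hi
  | succ k ih =>
    rw [Function.iterate_succ_apply, show i + (k + 1) = i + 1 + k by omega]
    exact ih (hP S hS) (hy S hS i hi)

/-- An orbit of odd period without fixed points, in which each point has a unique successor,
forces a horseshoe for an iterate of a monotone operator preserving intervals. -/
theorem hasHorseshoe_of_odd {X : Type*} [LinearOrder X] {Φ : Set X → Set X} (hΦ : Monotone Φ)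
    (hint : ∀ S, IsNondegInterval S → IsNondegInterval (Φ S)) {y : ℕ → X}
    (hy : ∀ S, IsNondegInterval S → ∀ i, y i ∈ S → y (i + 1) ∈ Φ S)
    {q : ℕ} (hq : Odd q) (hper : ∀ i, y (i + q) = y i) (hne : ∀ i, y (i + 1) ≠ y i)
    (hsucc : ∀ i j, y i = y j → y (i + 1) = y (j + 1)) :
    ∃ m, 0 < m ∧ HasHorseshoe Φ^[m] := by
  have hq0 : 0 < q := hq.pos
  have hmod : ∀ i, y (i % q) = y i := fun i => Function.Periodic.map_mod_nat hper i
  have hfin : (range y).Finite :=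
    ((finite_Iio q).image y).subset fun _ ⟨i, hi⟩ => ⟨i % q, Nat.mod_lt _ hq0, (hmod i).trans hi⟩
  have hex : ∃ i, y i < y (i + 1) := by
    obtain ⟨_, ⟨i, rfl⟩, hi⟩ := exists_min_image (range y) id hfin (range_nonempty y)
    exact ⟨i, lt_of_le_of_ne (hi _ ⟨i + 1, rfl⟩) (hne i).symm⟩
  -- `y i₀` is the rightmost orbit point that moves right, and `y j₀` is the next orbit point, which
  -- therefore moves left. The interval between them covers itself.
  obtain ⟨_, ⟨i₀, h₀, rfl⟩, hmax⟩ := exists_max_image (y '' {i | y i < y (i + 1)}) id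
    (hfin.subset (image_subset_range _ _)) (hex.elim fun i hi => ⟨_, i, hi, rfl⟩)
  obtain ⟨_, ⟨⟨j₀, rfl⟩, h₁⟩, hmin⟩ := exists_min_image (range y ∩ Ioi (y i₀)) id
    (hfin.subset inter_subset_left) ⟨_, ⟨i₀ + 1, rfl⟩, h₀⟩
  simp only [id, mem_Ioi, mem_ofPred_eq] at h₀ h₁ hmax hmin
  have hside : ∀ i, y i ≤ y i₀ ∨ y j₀ ≤ y i := fun i =>
    (le_or_gt (y i) (y i₀)).imp_right fun h => hmin _ ⟨⟨i, rfl⟩, h⟩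
  have hi₀ : y j₀ ≤ y (i₀ + 1) := (hside _).resolve_left h₀.not_ge
  have hj₀ : y (j₀ + 1) ≤ y i₀ := by
    refine (hside _).resolve_right fun h => ?_
    exact h₁.not_ge (hmax _ ⟨j₀, lt_of_le_of_ne h (hne j₀).symm, rfl⟩)
  have hI := isNondegInterval_Icc h₁
  have hII : Icc (y i₀) (y j₀) ⊆ Φ (Icc (y i₀) (y j₀)) := fun t ht =>
    (hint _ hI).ord.out (hy _ hI j₀ (right_mem_Icc.2 h₁.le)) (hy _ hI i₀ (left_mem_Icc.2 h₁.le))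
      ⟨hj₀.trans ht.1, ht.2.trans hi₀⟩
  have hmono := monotone_iterate_of_subset hΦ hII
  -- The exponent is `i - i₀` modulo `q`, written without negative numbers.
  have hall : ∀ i, y i ∈ Φ^[q] (Icc (y i₀) (y j₀)) := fun i => by
    have hlt : (i + (q - i₀ % q)) % q < q := Nat.mod_lt _ hq0
    have h := mem_iterate_of_orbit IsNondegInterval hint hy hI (left_mem_Icc.2 h₁.le)
      ((i + (q - i₀ % q)) % q)
    have heq : y (i₀ + (i + (q - i₀ % q)) % q) = y i := by
      rw [← hmod (i₀ + _), ← hmod i]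
      congr 1
      have h1 : i₀ % q < q := Nat.mod_lt _ hq0
      rw [Nat.add_mod_mod, ← Nat.mod_add_mod,
        show i₀ % q + (i + (q - i₀ % q)) = i + q by omega, Nat.add_mod_right]
    rw [heq] at h
    exact hmono hlt.le h
  have hord : (Φ^[q] (Icc (y i₀) (y j₀))).OrdConnected :=
    (Function.Iterate.rec (fun S => IsNondegInterval S) hI hint q).ord
  have hstep : ∀ S, Icc (y i₀) (y j₀) ⊆ Φ S → ∀ i j, Icc (y i) (y j) ⊆ Φ^[q + 1] S := by
    intro S hS i j
    rw [Function.iterate_succ_apply]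
    exact (hord.out (hall i) (hall j)).trans (hΦ.iterate q hS)
  -- If every orbit point changed sides, the period would be even.
  have hsame : ∃ i, (y i ≤ y i₀ ∧ y (i + 1) ≤ y i₀) ∨ (y j₀ ≤ y i ∧ y j₀ ≤ y (i + 1)) := by
    by_contra! h
    have halt : ∀ i, y (i + 1) ≤ y i₀ ↔ ¬ y i ≤ y i₀ := fun i =>
      ⟨fun h1 h2 => ((h i).1 h2).not_ge h1, fun h1 =>
        (hside _).resolve_right ((h i).2 ((hside i).resolve_left h1)).not_ge⟩
    have heven : ∀ k, y (i₀ + 2 * k) ≤ y i₀ := by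
      intro k
      induction k with
      | zero => exact le_rfl
      | succ k ih =>
        rw [show i₀ + 2 * (k + 1) = i₀ + 2 * k + 1 + 1 by ring, halt, halt, not_not]
        exact ih
    obtain ⟨k, hk⟩ := hq
    have h1 := hper i₀
    rw [hk, ← add_assoc] at h1
    exact (halt _).1 h1.le (heven k)
  refine ⟨q + 1, q.succ_pos, ?_⟩
  -- The interval between a point that keeps its side and the nearer of `y i₀`, `y j₀` also maps
  -- over the middle interval, because its two ends land on opposite sides. These two intervals are
  -- the legs.
  obtain ⟨i, ⟨h1, h2⟩ | ⟨h1, h2⟩⟩ := hsame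
  · have hlt : y i < y i₀ := lt_of_le_of_ne h1 fun h =>
      h₀.not_ge (hsucc i i₀ h ▸ h2)
    have hJ := isNondegInterval_Icc hlt
    refine ⟨y i, y i₀, y i₀, y j₀, hlt, le_rfl, h₁, hstep _ (fun t ht => ?_) _ _,
      hstep _ hII _ _⟩
    exact (hint _ hJ).ord.out (hy _ hJ i (left_mem_Icc.2 hlt.le))
      (hy _ hJ i₀ (right_mem_Icc.2 hlt.le)) ⟨h2.trans ht.1, ht.2.trans hi₀⟩
  · have hlt : y j₀ < y i := lt_of_le_of_ne h1 fun h =>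
      h₁.not_ge (h2.trans (hsucc i j₀ h.symm ▸ hj₀))
    have hJ := isNondegInterval_Icc hlt
    refine ⟨y i₀, y j₀, y j₀, y i, h₁, le_rfl, hlt, hstep _ hII _ _,
      hstep _ (fun t ht => ?_) _ _⟩
    exact (hint _ hJ).ord.out (hy _ hJ j₀ (left_mem_Icc.2 hlt.le))
      (hy _ hJ i (right_mem_Icc.2 hlt.le)) ⟨hj₀.trans ht.1, ht.2.trans h2⟩

/-- The least period divides every period. -/
theorem IsPeriodicOrbit.dvd {X : Type*} [TopologicalSpace X] {f : X → NonemptyCompacts X}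
    {x : ℕ → X} {n : ℕ} (hx : IsPeriodicOrbit f x n) {m : ℕ} (hm : ∀ i, x (m + i) = x i) :
    n ∣ m := by
  obtain ⟨⟨hn, hxn⟩, hleast⟩ := hx.2
  have hP : Function.Periodic x n := fun i => by rw [add_comm]; exact hxn i
  by_contra h
  have hpos : 0 < m % n := Nat.pos_of_ne_zero fun h0 => h (Nat.dvd_of_mod_eq_zero h0)
  refine (Nat.mod_lt m hn).not_ge (hleast ⟨hpos, fun i => ?_⟩)
  rw [← hm i, ← hP.map_mod_nat (m % n + i), Nat.mod_add_mod, hP.map_mod_nat]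

theorem IsOrbit.mem_iterate {x : ℕ → unitInterval} (hx : IsOrbit f x) {S : Set unitInterval}
    {i : ℕ} (hi : x i ∈ S) (k : ℕ) : x (i + k) ∈ (img f)^[k] S :=
  mem_iterate_of_orbit (Φ := img f) (fun _ => True) (fun _ _ => trivial) (fun _ _ i hi => ⟨x i, hi, hx i⟩)
    trivial hi k

/-- A periodic orbit that branches at a point forces a horseshoe. -/
theorem IsTame.hasHorseshoe_of_branching (hf : IsTame f) {x : ℕ → unitInterval} {n : ℕ}
    (hx : IsPeriodicOrbit f x n) {i j : ℕ} (hij : x i = x j) (hlt : x (i + 1) < x (j + 1)) :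
    HasHorseshoe (img f)^[n] := by
  obtain ⟨⟨hn, hxn⟩, -⟩ := hx.2
  obtain ⟨k, rfl⟩ : ∃ k, n = k + 1 := ⟨n - 1, by omega⟩
  obtain ⟨e, he₁, he₂⟩ := exists_between hlt
  have key : ∀ S, IsNondegInterval S → x i ∈ (img f)^[k] S →
      Icc (x (i + 1)) (x (j + 1)) ⊆ (img f)^[k + 1] S := by
    intro S hS h
    rw [Function.iterate_succ_apply']
    exact (hf.img_interval (hf.iterate_img_interval hS k)).ord.out ⟨x i, h, hx.1 i⟩
      ⟨x i, h, hij ▸ hx.1 j⟩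
  -- Since `k = n - 1`, one more step would complete the period.
  have hret : ∀ l S, x (l + 1) ∈ S → x l ∈ (img f)^[k] S := fun l S hl => by
    have := hx.1.mem_iterate hl k
    rwa [show l + 1 + k = k + 1 + l by omega, hxn] at this
  refine ⟨x (i + 1), e, e, x (j + 1), he₁, le_rfl, he₂, key _ (isNondegInterval_Icc he₁) ?_,
    key _ (isNondegInterval_Icc he₂) ?_⟩
  · exact hret i _ (left_mem_Icc.2 he₁.le)
  · exact hij ▸ hret j _ (right_mem_Icc.2 he₂.le)

/-- A periodic orbit whose period is not a power of two forces a horseshoe for an iterate. -/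
theorem IsTame.exists_horseshoe (hf : IsTame f) {x : ℕ → unitInterval} {n : ℕ}
    (hx : IsPeriodicOrbit f x n) (hn : ¬ ∃ k : ℕ, n = 2 ^ k) :
    ∃ m, 0 < m ∧ HasHorseshoe (img f)^[m] := by
  obtain ⟨⟨hn0, hxn⟩, -⟩ := hx.2
  by_cases hbr : ∃ i j, x i = x j ∧ x (i + 1) ≠ x (j + 1)
  · obtain ⟨i, j, hij, hne⟩ := hbr
    rcases lt_or_gt_of_ne hne with h | h
    · exact ⟨n, hn0, hf.hasHorseshoe_of_branching hx hij h⟩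
    · exact ⟨n, hn0, hf.hasHorseshoe_of_branching hx hij.symm h⟩
  push Not at hbr
  have hsucc : ∀ k i j, x i = x j → x (i + k) = x (j + k) := by
    intro k
    induction k with
    | zero => exact fun i j h => h
    | succ k ih => exact fun i j h => hbr _ _ (ih i j h)
  obtain ⟨k, q, hq, rfl⟩ := Nat.exists_eq_two_pow_mul_odd hn0.ne'
  have hP : Function.Periodic x (2 ^ k * q) := fun i => by rw [add_comm]; exact hxn i
  obtain ⟨m, hm, hhs⟩ := hasHorseshoe_of_odd (Φ := (img f)^[2 ^ k]) (y := fun i => x (2 ^ k * i))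
    ((img_mono f).iterate _) (fun S hS => hf.iterate_img_interval hS _)
    (fun S _ i hi => by simpa only [mul_add, mul_one] using hx.1.mem_iterate hi (2 ^ k)) hq
    (fun i => by simpa only [mul_add] using hP (2 ^ k * i))
    -- A repetition here would make `2 ^ k` a period of `x`, so the least period would divide it. A
    -- multiple of the period is added to the shift to keep the subtraction in `ℕ` exact.
    (fun i h => by
      refine hn ?_
      have hdvd : 2 ^ k * q ∣ 2 ^ k := hx.dvd fun t => by
        have h1 := hsucc (t + (2 ^ k * q) * i * 2 ^ k - 2 ^ k * i) _ _ h
        have h2 : 2 ^ k * i ≤ (2 ^ k * q) * i * 2 ^ k := by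
          calc 2 ^ k * i ≤ (2 ^ k * i) * (q * 2 ^ k) :=
                Nat.le_mul_of_pos_right _ (Nat.mul_pos hq.pos (by positivity))
            _ = _ := by ring
        have h3 := hP.nat_mul (i * 2 ^ k)
        rw [show 2 ^ k * (i + 1) + (t + (2 ^ k * q) * i * 2 ^ k - 2 ^ k * i)
              = (2 ^ k + t) + (i * 2 ^ k) * (2 ^ k * q) by
            rw [mul_add, mul_one, show (i * 2 ^ k) * (2 ^ k * q) = (2 ^ k * q) * i * 2 ^ k by ring]
            omega,
          show 2 ^ k * i + (t + (2 ^ k * q) * i * 2 ^ k - 2 ^ k * i)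
              = t + (i * 2 ^ k) * (2 ^ k * q) by
            rw [show (i * 2 ^ k) * (2 ^ k * q) = (2 ^ k * q) * i * 2 ^ k by ring]
            omega] at h1
        exact (h3 _).symm.trans (h1.trans (h3 _))
      obtain ⟨l, -, hl⟩ := (Nat.dvd_prime_pow Nat.prime_two).1 hdvd
      exact ⟨l, hl⟩)
    (fun i j h => by simpa only [mul_add, mul_one] using hsucc (2 ^ k) _ _ h)
  exact ⟨2 ^ k * m, by positivity, by rwa [Function.iterate_mul]⟩

/-! ### Connectedness of inverse limits -/

/-- The inverse limit of `f` restricted to a sequence `L` of factor sets. -/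
def inverseLimitIn (f : unitInterval → NonemptyCompacts unitInterval)
    (L : ℕ → Set unitInterval) : Set (ℕ → unitInterval) :=
  {x | ∀ i, x i ∈ L i ∧ x i ∈ f (x (i + 1))}

theorem IsUSC.isClosed_mem (hf : IsUSC f) (i j : ℕ) :
    IsClosed {x : ℕ → unitInterval | x i ∈ f (x j)} :=
  hf.isClosed_graph.preimage
    (f := fun x : ℕ → unitInterval => (x j, x i)) (by fun_prop)

theorem IsUSC.isClosed_inverseLimitIn (hf : IsUSC f) {L : ℕ → Set unitInterval}
    (hL : ∀ i, IsClosed (L i)) : IsClosed (inverseLimitIn f L) := by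
  have : inverseLimitIn f L =
      ⋂ i, {x : ℕ → unitInterval | x i ∈ L i} ∩ {x | x i ∈ f (x (i + 1))} := by
    ext x; simp [inverseLimitIn]
  rw [this]
  exact isClosed_iInter fun i => ((hL i).preimage (continuous_apply i)).inter (hf.isClosed_mem _ _)

/-- Imposing the relation `x k ∈ f (x l)` on a continuum in which the coordinate `k` is free
preserves connectedness. -/
theorem IsTame.isPreconnected_inter (hf : IsTame f) {C : Set (ℕ → unitInterval)} {k l : ℕ}
    (hkl : l ≠ k) (hC : IsClosed C) (hconn : IsPreconnected C)
    (hfree : ∀ x ∈ C, ∀ t, Function.update x k t ∈ C) :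
    IsPreconnected (C ∩ {x | x k ∈ f (x l)}) := by
  rw [isPreconnected_closed_iff]
  intro A B hA hB hAB hneA hneB
  set D := C ∩ {x : ℕ → unitInterval | x k ∈ f (x l)}
  have hDcl : IsClosed D := hC.inter (hf.usc.isClosed_mem _ _)
  let e : (ℕ → unitInterval) → (ℕ → unitInterval) := fun x => Function.update x k 0
  have he : Continuous e := continuous_id.update k continuous_const
  have hmemD : ∀ x ∈ C, ∀ t ∈ f (x l), Function.update x k t ∈ D := fun x hx t ht =>
    ⟨hfree x hx t, by simpa [Function.update_of_ne hkl] using ht⟩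
  have hcl : ∀ A : Set (ℕ → unitInterval), IsClosed A → IsClosed (e ⁻¹' (e '' (D ∩ A))) :=
    fun A hA => ((hDcl.inter hA).isCompact.image he).isClosed.preimage he
  have hmem : ∀ A x, x ∈ e ⁻¹' (e '' (D ∩ A)) → ∃ t ∈ f (x l), Function.update x k t ∈ A := by
    rintro A x ⟨z, ⟨hzD, hzA⟩, hz⟩
    have hzx : ∀ i, i ≠ k → z i = x i := fun i hi => by
      have := congrFun hz i
      simpa [e, Function.update_of_ne hi] using this
    refine ⟨z k, ?_, ?_⟩
    · rw [← hzx l hkl]; exact hzD.2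
    · convert hzA using 1
      ext i
      by_cases hi : i = k
      · subst hi; simp
      · rw [Function.update_of_ne hi, hzx i hi]
  -- After coordinate `k` is forgotten, the two closed pieces have overlapping shadows in `C`; the
  -- fibre over a common point is a copy of the interval `f (x l)` and meets both.
  obtain ⟨x, hxC, hxA, hxB⟩ := isPreconnected_closed_iff.1 hconn _ _ (hcl A hA) (hcl B hB)
    (fun x hx => by
      obtain ⟨t, ht⟩ := (f (x l)).nonempty
      have hxD := hmemD x hx t ht
      refine (hAB hxD).imp (fun h => ?_) (fun h => ?_) <;>
        exact ⟨_, ⟨hxD, h⟩, by simp [e]⟩)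
    (by obtain ⟨z, hz⟩ := hneA; exact ⟨z, hz.1.1, z, hz, rfl⟩)
    (by obtain ⟨z, hz⟩ := hneB; exact ⟨z, hz.1.1, z, hz, rfl⟩)
  obtain ⟨s, hs, hsA⟩ := hmem A x hxA
  obtain ⟨t, ht, htB⟩ := hmem B x hxB
  have hF : IsPreconnected ((fun t => Function.update x k t) '' (f (x l) : Set unitInterval)) :=
    (isPreconnected_iff_ordConnected.2 (hf.ordConnected_value _)).image _
      (continuous_const.update (f := fun _ => x) k continuous_id).continuousOn
  have hFD : (fun t => Function.update x k t) '' (f (x l) : Set unitInterval) ⊆ D := by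
    rintro _ ⟨t, ht, rfl⟩
    exact hmemD x hxC t ht
  exact (isPreconnected_closed_iff.1 hF A B hA hB (hFD.trans hAB)
    ⟨_, mem_image_of_mem _ hs, hsA⟩ ⟨_, mem_image_of_mem _ ht, htB⟩).mono
    (inter_subset_inter_left _ hFD)

/-- The sequences whose `N`-th term lies in `T` and whose terms with indices in `[k, N]` form a
backward orbit. -/
def chainsIn (f : unitInterval → NonemptyCompacts unitInterval) (T : Set unitInterval)
    (k N : ℕ) : Set (ℕ → unitInterval) :=
  {x | x N ∈ T ∧ ∀ i, k ≤ i → i < N → x i ∈ f (x (i + 1))}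

theorem IsUSC.isClosed_chainsIn (hf : IsUSC f) {T : Set unitInterval} (hT : IsClosed T)
    (k N : ℕ) : IsClosed (chainsIn f T k N) := by
  have : chainsIn f T k N = {x : ℕ → unitInterval | x N ∈ T} ∩
      ⋂ i, ⋂ (_ : k ≤ i), ⋂ (_ : i < N), {x | x i ∈ f (x (i + 1))} := by
    ext x; simp [chainsIn]
  rw [this]
  exact (hT.preimage (continuous_apply N)).inter (isClosed_iInter fun i => isClosed_iInter fun _ =>
    isClosed_iInter fun _ => hf.isClosed_mem _ _)

theorem IsTame.isPreconnected_chainsIn (hf : IsTame f) {T : Set unitInterval} (hT : IsClosed T)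
    (hconn : T.OrdConnected) {k N : ℕ} (hk : k ≤ N) : IsPreconnected (chainsIn f T k N) := by
  induction hk using Nat.decreasingInduction with
  | self =>
    have : chainsIn f T N N = Set.pi univ fun i => if i = N then T else univ := by
      ext x
      simp only [chainsIn, mem_ofPred_eq, mem_univ_pi]
      constructor
      · rintro ⟨h, -⟩ i
        split_ifs with hi
        · exact hi ▸ h
        · trivial
      · exact fun h => ⟨by simpa using h N, fun i h1 h2 => absurd h2 (by omega)⟩
    rw [this]
    refine isPreconnected_univ_pi fun i => ?_
    split_ifs
    · exact isPreconnected_iff_ordConnected.2 hconn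
    · exact isPreconnected_univ
  | of_succ k hk ih =>
    have : chainsIn f T k N = chainsIn f T (k + 1) N ∩ {x | x k ∈ f (x (k + 1))} := by
      ext x
      constructor
      · exact fun h => ⟨⟨h.1, fun i h1 h2 => h.2 i (by omega) h2⟩, h.2 k le_rfl hk⟩
      · rintro ⟨h, h'⟩
        refine ⟨h.1, fun i h1 h2 => ?_⟩
        rcases h1.eq_or_lt with rfl | h1
        · exact h'
        · exact h.2 i h1 h2
    rw [this]
    refine hf.isPreconnected_inter (by omega) (hf.usc.isClosed_chainsIn hT _ _) ih fun x hx t => ?_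
    refine ⟨?_, fun i h1 h2 => ?_⟩
    · rw [Function.update_of_ne (by omega)]; exact hx.1
    · rw [Function.update_of_ne (by omega), Function.update_of_ne (by omega)]
      exact hx.2 i h1 h2

/-- The intersection of a decreasing sequence of compact connected sets is connected. -/
theorem isPreconnected_iInter_of_antitone {X : Type*} [TopologicalSpace X] [T2Space X]
    {C : ℕ → Set X} (hanti : Antitone C) (hcomp : ∀ n, IsCompact (C n))
    (hconn : ∀ n, IsPreconnected (C n)) : IsPreconnected (⋂ n, C n) := by
  rw [isPreconnected_closed_iff]
  intro A B hA hB hAB hneA hneB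
  by_contra hdis
  have hK : IsCompact (⋂ n, C n) :=
    (hcomp 0).of_isClosed_subset (isClosed_iInter fun n => (hcomp n).isClosed) (iInter_subset C 0)
  obtain ⟨U, V, hU, hV, hAU, hBV, hUV⟩ := SeparatedNhds.of_isCompact_isCompact
    (hK.inter_right hA) (hK.inter_right hB) (disjoint_left.2 fun x h h' =>
      hdis ⟨x, h.1, h.2, h'.2⟩)
  obtain ⟨n, hn⟩ := exists_subset_nhds_of_isCompact (hanti.directed_ge) hcomp
    (U := U ∪ V) fun x hx => (hU.union hV).mem_nhds
      ((hAB hx).imp (fun h => hAU ⟨hx, h⟩) fun h => hBV ⟨hx, h⟩)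
  obtain ⟨x, -, hx⟩ := hconn n U V hU hV hn
    (hneA.mono fun x hx => ⟨iInter_subset C n hx.1, hAU hx⟩)
    (hneB.mono fun x hx => ⟨iInter_subset C n hx.1, hBV hx⟩)
  exact hUV.le_bot hx

/-- The finite chains ending in `L N` form a decreasing sequence of continua with this intersection;
`himg` makes it decreasing and puts every coordinate in its factor. -/
theorem IsTame.isPreconnected_inverseLimitIn (hf : IsTame f) {L : ℕ → Set unitInterval}
    (hcl : ∀ i, IsClosed (L i)) (hord : ∀ i, (L i).OrdConnected)
    (himg : ∀ i, img f (L (i + 1)) = L i) : IsPreconnected (inverseLimitIn f L) := by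
  have hanti : Antitone fun N => chainsIn f (L N) 0 N := antitone_nat_of_succ_le fun N x hx =>
    ⟨himg N ▸ ⟨_, hx.1, hx.2 N (Nat.zero_le _) N.lt_succ_self⟩,
      fun i h1 h2 => hx.2 i h1 (h2.trans N.lt_succ_self)⟩
  have : inverseLimitIn f L = ⋂ N, chainsIn f (L N) 0 N := by
    ext x
    simp only [inverseLimitIn, mem_ofPred_eq, mem_iInter]
    exact ⟨fun h N => ⟨(h N).1, fun i _ _ => (h i).2⟩,
      fun h i => ⟨(h i).1, (h (i + 1)).2 i (Nat.zero_le _) i.lt_succ_self⟩⟩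
  rw [this]
  exact isPreconnected_iInter_of_antitone hanti
    (fun N => (hf.usc.isClosed_chainsIn (hcl N) 0 N).isCompact)
    fun N => hf.isPreconnected_chainsIn (hcl N) (hord N) (Nat.zero_le N)

theorem exists_mem_inverseLimitIn {L : ℕ → Set unitInterval}
    (himg : ∀ i, img f (L (i + 1)) = L i) (n : ℕ) {t : unitInterval} (ht : t ∈ L n) :
    ∃ x ∈ inverseLimitIn f L, x n = t := by
  induction n generalizing L t with
  | zero =>
    have hex : ∀ i (s : L i), ∃ r : L (i + 1), s.1 ∈ f r.1 := fun i s => by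
      obtain ⟨r, hr, hs⟩ := (himg i).ge s.2
      exact ⟨⟨r, hr⟩, hs⟩
    choose g hg using hex
    let x : ∀ i, L i := fun i => Nat.rec (motive := fun i => L i) ⟨t, ht⟩ g i
    refine ⟨fun i => (x i).1, fun i => ⟨(x i).2, hg i (x i)⟩, ?_⟩
    rfl
  | succ n ih =>
    obtain ⟨x, hx, hxn⟩ := ih (L := fun i => L (i + 1)) (fun i => himg (i + 1)) ht
    obtain ⟨s, hs⟩ := (f (x 0)).nonempty
    refine ⟨fun i => Nat.casesOn i s x, fun i => ?_, hxn⟩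
    cases i with
    | zero => exact ⟨himg 0 ▸ ⟨_, (hx 0).1, hs⟩, hs⟩
    | succ i => exact hx i

/-! ### Projections of closed subsets -/

/-- If the `(n + 1)`-st projection of a closed subset of the inverse limit contains a nondegenerate
interval, then the `n`-th projection contains the image of that interval. -/
theorem IsTame.img_subset_proj (hf : IsTame f) {A : Set (ℕ → unitInterval)} (hA : IsClosed A)
    (hAf : A ⊆ inverseLimit f) {S : Set unitInterval} (hS : IsNondegInterval S) {n : ℕ}
    (h : S ⊆ (fun x => x (n + 1)) '' A) : img f S ⊆ (fun x => x n) '' A := by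
  rintro w ⟨s, hs, hw⟩
  rw [← (hA.isCompact.image (continuous_apply n)).isClosed.closure_eq]
  refine mem_closure_iff.2 fun U hU hwU => ?_
  obtain ⟨W, hWS, -, ⟨u, hu⟩, hWU⟩ := hf.exists_open_subset hS hs hw hU hwU
  obtain ⟨a, ha, rfl⟩ := h (hWS hu)
  exact ⟨a n, hWU _ hu (hAf ha n), a, ha, rfl⟩

theorem IsTame.iterate_img_subset_proj (hf : IsTame f) {A : Set (ℕ → unitInterval)}
    (hA : IsClosed A) (hAf : A ⊆ inverseLimit f) {S : Set unitInterval} (hS : IsNondegInterval S)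
    {n : ℕ} (k : ℕ) (h : S ⊆ (fun x => x (n + k)) '' A) :
    (img f)^[k] S ⊆ (fun x => x n) '' A := by
  induction k generalizing n with
  | zero => exact h
  | succ k ih =>
    rw [Function.iterate_succ_apply']
    refine hf.img_subset_proj hA hAf (hf.iterate_img_interval hS k) (ih ?_)
    rwa [show n + 1 + k = n + (k + 1) by omega]

/-- A closed subset of the inverse limit with full projections is dense in it. -/
theorem IsTame.inverseLimitIn_subset (hf : IsTame f) {L : ℕ → Set unitInterval}
    (hL : ∀ i, IsNondegInterval (L i)) {A : Set (ℕ → unitInterval)} (hA : IsClosed A)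
    (hAf : A ⊆ inverseLimit f) (hproj : ∀ n, L n ⊆ (fun x => x n) '' A) :
    inverseLimitIn f L ⊆ A := by
  intro x hx
  rw [← hA.closure_eq]
  refine mem_closure_iff.2 fun O hO hxO => ?_
  obtain ⟨F, u, hu, hFO⟩ := isOpen_pi_iff.1 hO x hxO
  obtain ⟨W, hWL, -, ⟨w, hw⟩, htube⟩ := hf.exists_tube
    (U := fun i => {t | i ∈ F → t ∈ u i})
    (fun i => by
      by_cases hi : i ∈ F
      · simpa [hi] using (hu i hi).1
      · simp [hi])
    (x := x) (fun i hi => (hu i hi).2) (fun i => (hx i).2) (F.sup id) (hL _) (hx _).1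
  obtain ⟨a, ha, rfl⟩ := hproj _ (hWL hw)
  exact ⟨a, hFO fun i hi => htube a (fun i _ => hAf ha i) hw i (Finset.le_sup (f := id) hi) hi, ha⟩

/-! ### Hulls of iterates and indecomposability -/

/-- The closure of the union of the images of `J` under the iterates of `f` with exponents
`r, m + r, 2 m + r, …`. -/
def iterateHull (f : unitInterval → NonemptyCompacts unitInterval) (J : Set unitInterval)
    (m r : ℕ) : Set unitInterval :=
  closure (⋃ n, (img f)^[n * m + r] J)

variable {J : Set unitInterval} {m : ℕ}

theorem monotone_iterate_img (hJm : J ⊆ (img f)^[m] J) (r : ℕ) :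
    Monotone fun n => (img f)^[n * m + r] J := by
  have h := monotone_iterate_of_subset ((img_mono f).iterate m) hJm
  intro a b hab
  simp only [add_comm _ r, Function.iterate_add_apply, mul_comm _ m, Function.iterate_mul]
  exact (img_mono f).iterate r (h hab)

/-- Dropping the first term of an increasing union changes nothing, so only the residue of `r`
modulo `m` matters. -/
theorem iterateHull_add_period (hJm : J ⊆ (img f)^[m] J) (r : ℕ) :
    iterateHull f J m (r + m) = iterateHull f J m r := by
  unfold iterateHull
  congr 1
  have h := (monotone_iterate_img hJm r).iUnion_nat_add 1
  rw [← h]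
  refine iUnion_congr fun n => ?_
  rw [show n * m + (r + m) = (n + 1) * m + r by ring]

theorem iterateHull_mul_period (hJm : J ⊆ (img f)^[m] J) (r k : ℕ) :
    iterateHull f J m (r + k * m) = iterateHull f J m r := by
  induction k with
  | zero => simp
  | succ k ih => rw [add_mul, one_mul, ← add_assoc, iterateHull_add_period hJm, ih]

theorem IsTame.isNondegInterval_iUnion (hf : IsTame f) (hJ : IsNondegInterval J)
    (hJm : J ⊆ (img f)^[m] J) (r : ℕ) : IsNondegInterval (⋃ n, (img f)^[n * m + r] J) := by
  refine ⟨⟨fun x hx y hy => ?_⟩, ?_⟩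
  · obtain ⟨a, ha⟩ := mem_iUnion.1 hx
    obtain ⟨b, hb⟩ := mem_iUnion.1 hy
    have hmono := monotone_iterate_img hJm r
    exact ((hf.iterate_img_interval hJ _).ord.out (hmono (le_max_left a b) ha)
      (hmono (le_max_right a b) hb)).trans
      (subset_iUnion (fun n => (img f)^[n * m + r] J) (max a b))
  · exact (hf.iterate_img_interval hJ _).nontrivial.mono
      (subset_iUnion (fun n => (img f)^[n * m + r] J) 0)

theorem IsTame.img_iterateHull (hf : IsTame f) (hJ : IsNondegInterval J)
    (hJm : J ⊆ (img f)^[m] J) (r : ℕ) :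
    img f (iterateHull f J m r) = iterateHull f J m (r + 1) := by
  rw [iterateHull, hf.img_closure (hf.isNondegInterval_iUnion hJ hJm r), iterateHull]
  congr 1
  ext y
  simp only [← add_assoc, Function.iterate_succ_apply', mem_iUnion]
  constructor
  · rintro ⟨x, hx, hy⟩
    obtain ⟨n, hn⟩ := mem_iUnion.1 hx
    exact ⟨n, x, hn, hy⟩
  · rintro ⟨n, x, hn, hy⟩
    exact ⟨x, mem_iUnion.2 ⟨n, hn⟩, hy⟩

/-- Of two intervals covering two nonoverlapping intervals and the gap between them, one contains
one of these two. -/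
theorem Icc_subset_of_cover {X : Type*} [LinearOrder X] {A B : Set X} (hA : A.OrdConnected)
    (hB : B.OrdConnected) {p₁ p₂ q₁ q₂ : X} (hp : p₁ < p₂) (hpq : p₂ ≤ q₁) (hq : q₁ < q₂)
    (hcov : Icc p₁ q₂ ⊆ A ∪ B) :
    (Icc p₁ p₂ ⊆ A ∨ Icc q₁ q₂ ⊆ A) ∨ (Icc p₁ p₂ ⊆ B ∨ Icc q₁ q₂ ⊆ B) := by
  have hp₁ := hcov ⟨le_rfl, (hp.le.trans hpq).trans hq.le⟩
  have hp₂ := hcov ⟨hp.le, hpq.trans hq.le⟩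
  have hq₂ := hcov ⟨(hp.le.trans hpq).trans hq.le, le_rfl⟩
  have key : ∀ C : Set X, C.OrdConnected → (p₁ ∈ C → p₂ ∈ C → Icc p₁ p₂ ⊆ C) ∧
      (p₂ ∈ C → q₂ ∈ C → Icc q₁ q₂ ⊆ C) ∧ (p₁ ∈ C → q₂ ∈ C → Icc p₁ p₂ ⊆ C) := fun C hC =>
    ⟨fun h h' => hC.out h h', fun h h' => (Icc_subset_Icc_left hpq).trans (hC.out h h'),
      fun h h' => (Icc_subset_Icc_right (hpq.trans hq.le)).trans (hC.out h h')⟩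
  obtain ⟨a₁, a₂, a₃⟩ := key A hA
  obtain ⟨b₁, b₂, b₃⟩ := key B hB
  rcases hp₁ with h₁ | h₁ <;> rcases hp₂ with h₂ | h₂
  · exact .inl (.inl (a₁ h₁ h₂))
  · exact hq₂.imp (fun h => .inl (a₃ h₁ h)) fun h => .inr (b₂ h₂ h)
  · exact hq₂.imp (fun h => .inr (a₂ h₂ h)) fun h => .inl (b₃ h₁ h)
  · exact .inr (.inl (b₁ h₁ h₂))

/-- A horseshoe for an iterate of `f` yields an indecomposable subcontinuum of the inverse
limit. -/
theorem IsTame.exists_indecomposable (hf : IsTame f) (hm : 0 < m)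
    (hhs : HasHorseshoe (img f)^[m]) :
    ∃ K ⊆ inverseLimit f, IsIndecomposableContinuum K := by
  obtain ⟨p₁, p₂, q₁, q₂, hp, hpq, hq, hP, hQ⟩ := hhs
  set J := Icc p₁ q₂
  have hJ : IsNondegInterval J := isNondegInterval_Icc ((hp.trans_le hpq).trans hq)
  have hJm : J ⊆ (img f)^[m] J := hP.trans
    ((img_mono f).iterate m (Icc_subset_Icc_right (hpq.trans hq.le)))
  -- The residue must drop by one from each level to the next; `m - 1` stands for `-1` modulo `m`.
  set L : ℕ → Set unitInterval := fun i => iterateHull f J m ((m - 1) * i) with hL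
  have hLint : ∀ i, IsNondegInterval (L i) := fun i =>
    (hf.isNondegInterval_iUnion hJ hJm _).closure
  have hLcl : ∀ i, IsClosed (L i) := fun i => isClosed_closure
  have himg : ∀ i, img f (L (i + 1)) = L i := fun i => by
    rw [hL]
    simp only
    rw [hf.img_iterateHull hJ hJm, ← iterateHull_add_period hJm ((m - 1) * i), mul_add, mul_one,
      add_assoc, Nat.sub_add_cancel hm]
  have hLmul : ∀ j, L (j * m) = iterateHull f J m 0 := fun j => by
    rw [hL]
    simp only
    rw [← mul_assoc, ← zero_add ((m - 1) * j * m), iterateHull_mul_period hJm]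
  have hJL : ∀ j, J ⊆ L (j * m) := fun j => by
    rw [hLmul]
    exact (subset_iUnion (fun n => (img f)^[n * m + 0] J) 0 |>.trans' (by simp)).trans
      subset_closure
  have hKf : inverseLimitIn f L ⊆ inverseLimit f := fun x hx i => (hx i).2
  have hKne : (inverseLimitIn f L).Nontrivial := by
    obtain ⟨s, hs, t, ht, hst⟩ := (hLint 0).nontrivial
    obtain ⟨x, hx, rfl⟩ := exists_mem_inverseLimitIn himg 0 hs
    obtain ⟨y, hy, rfl⟩ := exists_mem_inverseLimitIn himg 0 ht
    exact ⟨x, hx, y, hy, fun h => hst (by rw [h])⟩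
  have hfull : ∀ A : Set (ℕ → unitInterval), IsClosed A → A ⊆ inverseLimit f →
      (∀ N, ∃ j ≥ N, J ⊆ (fun x => x (j * m)) '' A) → inverseLimitIn f L ⊆ A := by
    intro A hA hAf hfreq
    -- A copy of `J` at a level beyond `(j + n) * m` is pushed down to level `j * m` and covers the
    -- `n`-th set in the union whose closure is `L (j * m)`.
    have hmul : ∀ j, L (j * m) ⊆ (fun x => x (j * m)) '' A := by
      intro j
      rw [hLmul]
      refine closure_minimal (iUnion_subset fun n => ?_)
        (hA.isCompact.image (continuous_apply _)).isClosed
      obtain ⟨i, hi, hJi⟩ := hfreq (j + n)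
      refine Subset.trans ?_ (hf.iterate_img_subset_proj hA hAf hJ ((i - j) * m)
        (n := j * m) ?_)
      · exact monotone_iterate_img hJm 0 (show n ≤ i - j by omega)
      · rwa [← add_mul, Nat.add_sub_cancel' (by omega)]
    refine hf.inverseLimitIn_subset hLint hA hAf fun n => ?_
    have hiter : ∀ k, (img f)^[k] (L (n + k)) = L n := by
      intro k
      induction k with
      | zero => rfl
      | succ k ih => rw [Function.iterate_succ_apply, ← add_assoc, himg, ih]
    have hle : n ≤ n * m := Nat.le_mul_of_pos_right _ hm
    have h := hf.iterate_img_subset_proj hA hAf (hLint _) (n := n) (n * m - n)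
      (by rw [Nat.add_sub_cancel' hle]; exact hmul n)
    rwa [← Nat.add_sub_cancel' hle, Nat.add_sub_cancel_left, hiter] at h
  refine ⟨inverseLimitIn f L, hKf,
    ⟨(hf.usc.isClosed_inverseLimitIn hLcl).isCompact, hKne.nonempty,
      hf.isPreconnected_inverseLimitIn hLcl (fun i => (hLint i).ord) himg⟩, hKne, ?_⟩
  rintro ⟨A, B, hA, hB, hAK, hBK, hAB⟩
  have hAf := hAK.subset.trans hKf
  have hBf := hBK.subset.trans hKf
  have hproj : ∀ C : Set (ℕ → unitInterval), IsContinuum C → ∀ n,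
      ((fun x => x n) '' C).OrdConnected := fun C hC n => isPreconnected_iff_ordConnected.1
    (hC.2.isPreconnected.image _ (continuous_apply n).continuousOn)
  have hback : ∀ C : Set (ℕ → unitInterval), IsContinuum C → C ⊆ inverseLimit f → ∀ j,
      (Icc p₁ p₂ ⊆ (fun x => x ((j + 1) * m)) '' C ∨ Icc q₁ q₂ ⊆ (fun x => x ((j + 1) * m)) '' C) →
      J ⊆ (fun x => x (j * m)) '' C := by
    intro C hC hCf j h
    rw [add_mul, one_mul] at h
    rcases h with h | h
    · exact hP.trans (hf.iterate_img_subset_proj hC.1.isClosed hCf (isNondegInterval_Icc hp) m h)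
    · exact hQ.trans (hf.iterate_img_subset_proj hC.1.isClosed hCf (isNondegInterval_Icc hq) m h)
  -- The projections of `A` and `B` cover `J` at level `(j + 1) * m`, so one of them contains a leg,
  -- which stretches over `J` at level `j * m`.
  have hor : ∀ j, J ⊆ (fun x => x (j * m)) '' A ∨ J ⊆ (fun x => x (j * m)) '' B := by
    intro j
    refine (Icc_subset_of_cover (hproj A hA ((j + 1) * m)) (hproj B hB ((j + 1) * m)) hp hpq hq
      fun t ht => ?_).imp (hback A hA hAf j) (hback B hB hBf j)
    obtain ⟨x, hx, rfl⟩ := exists_mem_inverseLimitIn himg ((j + 1) * m) (hJL (j + 1) ht)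
    rw [← hAB] at hx
    exact hx.imp (fun h => ⟨x, h, rfl⟩) fun h => ⟨x, h, rfl⟩
  by_cases h : ∀ N, ∃ j ≥ N, J ⊆ (fun x => x (j * m)) '' A
  · exact hAK.not_subset (hfull A hA.1.isClosed hAf h)
  · push Not at h
    obtain ⟨N, hN⟩ := h
    refine hBK.not_subset (hfull B hB.1.isClosed hBf fun M => ⟨max M N, le_max_left _ _, ?_⟩)
    exact (hor _).resolve_left (hN _ (le_max_right _ _))

end SetValued

theorem mainTheorem2
    (f : unitInterval → TopologicalSpace.NonemptyCompacts unitInterval)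
    (husc : SetValued.IsUSC f)
    (hsurj : SetValued.IsSurjective f)
    (hanf : SetValued.IsAlmostNonfissile f)
    (hlight : SetValued.IsLight f)
    (hivp : SetValued.HasIVP f)
    (hint : interior (SetValued.graph f) = ∅)
    (hper : ∃ (x : ℕ → unitInterval) (n : ℕ),
      SetValued.IsPeriodicOrbit f x n ∧ ¬ ∃ k : ℕ, n = 2 ^ k) :
    ∃ K : Set (ℕ → unitInterval),
      K ⊆ SetValued.inverseLimit f ∧ IsIndecomposableContinuum K := by
  have hf : SetValued.IsTame f := ⟨husc, hanf.1, hlight, hivp⟩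
  obtain ⟨x, n, hx, hn⟩ := hper
  obtain ⟨m, hm, hhs⟩ := hf.exists_horseshoe hx hn
  exact hf.exists_indecomposable hm hhs
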